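/- All $\lambda$-terms are pure untyped $\lambda$-terms, and $F,G,H,J,M,N,P,Q,R$ denote closed terms. Write $\twoheadrightarrow_{\beta}$, $\twoheadrightarrow_{\eta}$, $\twoheadrightarrow_{\beta\eta}$ for reduction in any number of steps. **Equality in $\lambda\omega$.** $=_\omega$ is the least relation between closed terms that contains $\beta\eta$-conversion, is symmetric and transitive, satisfies $M=_\omega N\Rightarrow PM=_\omega PN$, and is closed under the $\omega$-rule: if $PR=_\omega QR$ for every closed $R$, then $P=_\omega Q$. **Proofs.** A proof of $F=_\omega F'$ is a well-founded tree which either - ends in an instance of the $\omega$-rule, with a proof of $FR=_\omega F'R$ for every closed $R$; or - ends in an endpiece, i.e. for some $t\ge 0$ a chain $$F\twoheadrightarrow_{\beta\eta}H_1\twoheadleftarrow_{\beta\eta}G_1M_1=_\omega G_1N_1\twoheadrightarrow_{\beta\eta}H_2\twoheadleftarrow_{\beta\eta}\cdots\; G_tM_t=_\omega G_tN_t\twoheadrightarrow_{\beta\eta}H_{t+1}\twoheadleftarrow_{\beta\eta}F'$$ whose leaves $M_i=_\omega N_i$ $(1\le i\le t)$ are direct conclusions of the $\omega$-rule, with proofs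 of all the premises. For $t=0$ this is a single $\beta\eta$-conversion $F\twoheadrightarrow_{\beta\eta}H_1\twoheadleftarrow_{\beta\eta}F'$. **Supercofinal sets.** A zero-term is a term that does not $\beta$-reduce to an abstraction. A set $\mathcal X$ of closed terms is *supercofinal* if every closed term has a $\beta\eta$-reduct in $\mathcal X$ and $\mathcal X$ contains every closed term that does not $\beta\eta$-reduce to a zero-term. **Canonical proofs.** Let $\mathcal X$ be supercofinal. A proof ending in the $\omega$-rule is *$\mathcal X$-canonical* if the proofs of all its premises are. A proof ending in an endpiece as above is *$\mathcal X$-canonical* if the proofs of all the premises of its leaves are $\mathcal X$-canonical, all confluence terms $H_1,\dots,H_{t+1}$ belong to $\mathcal X$, and for every $i$ with $1\le i\le t$ there are $m,n\ge 0$ and terms $Y,L_1,\dots,L_m,Z_1,\dots,Z_n$ with $$G_i\equiv\lambda x.\,\lambda y_1\dots y_n.\,((\lambda y.Y)L_1\cdots L_m)Z_1\cdots Z_n$$ such that: - (left) $G_iM_i\twoheadrightarrow_{\beta\eta}H_i$ by a reduction consisting of the one $\beta$-step to $[M_i/x](\lambda y_1\dots y_n.((\lambda y.Y)L_1\cdots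 L_m)Z_1\cdots Z_n)$, followed by contractions of $\beta$-redexes other than the head redex, followed by $\eta$-steps; - (right) $G_iN_i\twoheadrightarrow_{\beta\eta}H_{i+1}$ by a reduction of the form $$\begin{aligned}G_iN_i&\twoheadrightarrow_{\beta\eta}[N_i/x](\lambda y_1\dots y_n.((\lambda y.Y)L_1\cdots L_m)Z_1\cdots Z_n)\\&\twoheadrightarrow_{\beta\eta}\lambda y_1\dots y_n.\,([N_i/x](\lambda y.Y)\,[N_i/x]L_1\cdots[N_i/x]L_m)\,y_1\cdots y_n\\&\twoheadrightarrow_{\eta}[N_i/x](\lambda y.Y)\,[N_i/x]L_1\cdots[N_i/x]L_m\twoheadrightarrow_{\beta\eta}J_0J_1\cdots J_m\twoheadrightarrow_{\beta\eta}H_{i+1},\end{aligned}$$ where $J_0$ is the $\beta\eta$-normal form of $[N_i/x](\lambda y.Y)$ if it exists and $[N_i/x](\lambda y.Y)$ itself otherwise, and $J_k$ $(1\le k\le m)$ is obtained from $[N_i/x]L_k$ in the same way. **Proposition.** For every supercofinal set $\mathcal X$ and all closed terms $M,N$: if $M=_\omega N$, then there is an $\mathcal X$-canonical proof of $M=_\omega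 N$. -/

import Mathlib

open Relation

namespace LambdaOmega

/-- Pure untyped `λ`-terms up to renaming of bound variables (well-scoped de Bruijn terms):
`Term n` consists of the terms whose free variables are among `n` given ones, where the variable
`0` is the one bound innermost. `Term 0` is the set of closed terms. -/
inductive Term : ℕ → Type
  | var {n : ℕ} (i : Fin n) : Term n
  | app {n : ℕ} (s t : Term n) : Term n
  | lam {n : ℕ} (t : Term (n + 1)) : Term n

namespace Term

/-- Renaming of free variables. -/
def rename : {m n : ℕ} → (Fin m → Fin n) → Term m → Term n
  | _, _, f, var i => var (f i)
  | _, _, f, app s t => app (rename f s) (rename f t)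
  | _, _, f, lam t => lam (rename (Fin.cases 0 fun i => (f i).succ) t)

/-- Simultaneous capture-avoiding substitution. -/
def subst : {m n : ℕ} → (Fin m → Term n) → Term m → Term n
  | _, _, f, var i => f i
  | _, _, f, app s t => app (subst f s) (subst f t)
  | _, _, f, lam t => lam (subst (Fin.cases (var 0) fun i => rename Fin.succ (f i)) t)

/-- `inst t u` is `[u/x]t`, where `x` is the variable `0` of `t`. -/
def inst {n : ℕ} (t : Term (n + 1)) (u : Term n) : Term n :=
  subst (Fin.cases u var) t

/-- `apps s [t₁, …, tₘ]` is `s t₁ ⋯ tₘ`. -/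
def apps {n : ℕ} (s : Term n) (ts : List (Term n)) : Term n :=
  ts.foldl app s

/-- `lams n t` is `λ y₁ … yₙ. t`; in `t` the variable `yⱼ` has index `n - j`, and the `k`
variables of the context have the indices `n, …, n + k - 1`. -/
def lams {k : ℕ} : (n : ℕ) → Term (k + n) → Term k
  | 0, t => t
  | n + 1, t => lams n (lam t)

/-- The term `t`, placed in the scope of `n` further binders (whose variables it does not
contain). -/
def weaken {k : ℕ} (n : ℕ) (t : Term k) : Term (k + n) :=
  rename (fun i => i.addNat n) t

/-- The list `y₁, …, yₙ` of the variables bound by `lams n`. -/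
def boundVars (k n : ℕ) : List (Term (k + n)) :=
  List.ofFn fun j : Fin n => var ((Fin.rev j).castLE (Nat.le_add_left n k))

end Term

open Term

/-- One-step `β`-reduction. -/
inductive Beta : {n : ℕ} → Term n → Term n → Prop
  | beta {n : ℕ} (t : Term (n + 1)) (u : Term n) : Beta (app (lam t) u) (inst t u)
  | appL {n : ℕ} {s s' : Term n} (t : Term n) : Beta s s' → Beta (app s t) (app s' t)
  | appR {n : ℕ} (s : Term n) {t t' : Term n} : Beta t t' → Beta (app s t) (app s t')
  | lam {n : ℕ} {t t' : Term (n + 1)} : Beta t t' → Beta (lam t) (lam t')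

/-- One-step `η`-reduction. -/
inductive Eta : {n : ℕ} → Term n → Term n → Prop
  | eta {n : ℕ} (t : Term n) : Eta (lam (app (rename Fin.succ t) (var 0))) t
  | appL {n : ℕ} {s s' : Term n} (t : Term n) : Eta s s' → Eta (app s t) (app s' t)
  | appR {n : ℕ} (s : Term n) {t t' : Term n} : Eta t t' → Eta (app s t) (app s t')
  | lam {n : ℕ} {t t' : Term (n + 1)} : Eta t t' → Eta (lam t) (lam t')

/-- One-step `βη`-reduction. -/
def BetaEta {n : ℕ} (s t : Term n) : Prop := Beta s t ∨ Eta s t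

/-- Contraction of a `β`-redex other than the head redex. The head redex of a term
`λ y₁ … yₙ. (λ y. A) B C₁ ⋯ Cₘ` is `(λ y. A) B`; terms of any other shape have none. -/
inductive NonHeadBeta : {n : ℕ} → Term n → Term n → Prop
  | lam {n : ℕ} {t t' : Term (n + 1)} : NonHeadBeta t t' → NonHeadBeta (lam t) (lam t')
  | appR {n : ℕ} (s : Term n) {t t' : Term n} : Beta t t' → NonHeadBeta (app s t) (app s t')
  | appLam {n : ℕ} {s s' : Term (n + 1)} (t : Term n) :
      Beta s s' → NonHeadBeta (app (lam s) t) (app (lam s') t)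
  | appL {n : ℕ} {s s' : Term n} (t : Term n) :
      NonHeadBeta s s' → NonHeadBeta (app s t) (app s' t)

/-- `β`-reduction in any number of steps. -/
def BetaRed {n : ℕ} (s t : Term n) : Prop := ReflTransGen Beta s t

/-- `η`-reduction in any number of steps. -/
def EtaRed {n : ℕ} (s t : Term n) : Prop := ReflTransGen Eta s t

/-- `βη`-reduction in any number of steps. -/
def BetaEtaRed {n : ℕ} (s t : Term n) : Prop := ReflTransGen BetaEta s t

/-- Any number of non-head `β`-reduction steps. -/
def NonHeadRed {n : ℕ} (s t : Term n) : Prop := ReflTransGen NonHeadBeta s t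

/-- `βη`-conversion. -/
def BetaEtaConv {n : ℕ} (s t : Term n) : Prop := EqvGen BetaEta s t

/-- `βη`-normal forms. -/
def IsNormal {n : ℕ} (t : Term n) : Prop := ∀ t', ¬ BetaEta t t'

/-- Equality in `λω`, between closed terms. -/
inductive OmegaEq : Term 0 → Term 0 → Prop
  | conv {M N : Term 0} : BetaEtaConv M N → OmegaEq M N
  | app (P : Term 0) {M N : Term 0} : OmegaEq M N → OmegaEq (app P M) (app P N)
  | symm {M N : Term 0} : OmegaEq M N → OmegaEq N M
  | trans {M N P : Term 0} : OmegaEq M N → OmegaEq N P → OmegaEq M P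
  | omega {P Q : Term 0} : (∀ R : Term 0, OmegaEq (Term.app P R) (Term.app Q R)) → OmegaEq P Q

/-- Proofs in `λω`, as well-founded trees whose endpieces are in standard form. A proof of
`F = F'` either ends in an instance of the `ω`-rule, or it ends in an endpiece
`F ↠ H₀ ↞ G₀ M₀ = G₀ N₀ ↠ H₁ ↞ G₁ M₁ = G₁ N₁ ↠ ⋯ ↠ H_t ↞ F'` (with `βη`-reductions), in which
each of the `t` equations `Mᵢ = Nᵢ` is a direct conclusion of the `ω`-rule, with the premises
`Mᵢ R = Nᵢ R` proved by the trees `leaf i R`. For `t = 0` the endpiece is a single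
`βη`-conversion `F ↠ H₀ ↞ F'`. -/
inductive ProofTree : Term 0 → Term 0 → Type
  | omega {P Q : Term 0} (prem : ∀ R : Term 0, ProofTree (app P R) (app Q R)) : ProofTree P Q
  | endpiece {F F' : Term 0} (t : ℕ) (G M N : Fin t → Term 0) (H : Fin (t + 1) → Term 0)
      (first : BetaEtaRed F (H 0))
      (left : ∀ i : Fin t, BetaEtaRed (app (G i) (M i)) (H i.castSucc))
      (right : ∀ i : Fin t, BetaEtaRed (app (G i) (N i)) (H i.succ))
      (last : BetaEtaRed F' (H (Fin.last t)))
      (leaf : ∀ (i : Fin t) (R : Term 0), ProofTree (app (M i) R) (app (N i) R)) :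
      ProofTree F F'

/-- Zero-terms, i.e. (closed) terms of order `0`: those that do not reduce to an abstraction. -/
def IsZeroTerm (M : Term 0) : Prop := ∀ P : Term 1, ¬ BetaRed M (lam P)

/-- Cofinality for `βη`-reduction. -/
def Cofinal (X : Set (Term 0)) : Prop := ∀ M : Term 0, ∃ H ∈ X, BetaEtaRed M H

/-- Supercofinal sets of closed terms. -/
def Supercofinal (X : Set (Term 0)) : Prop :=
  Cofinal X ∧ ∀ M : Term 0, (¬ ∃ Z : Term 0, IsZeroTerm Z ∧ BetaEtaRed M Z) → M ∈ X

/-- `J` is the `βη`-normal form of `A`, if there is one, and `A` itself otherwise. -/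
def IsNormalFormOrSelf {n : ℕ} (A J : Term n) : Prop :=
  (BetaEtaRed A J ∧ IsNormal J) ∨ ((¬ ∃ K, BetaEtaRed A K ∧ IsNormal K) ∧ J = A)

/-- The term `(λ y. Y) L₁ ⋯ Lₘ`, whose only free variable is `x`. -/
def headPart (Y : Term 2) (L : List (Term 1)) : Term 1 := apps (lam Y) L

/-- The term `λ y₁ … yₙ. ((λ y. Y) L₁ ⋯ Lₘ) Z₁ ⋯ Zₙ`, whose only free variable is `x`. The `Zⱼ`
may contain `x, y₁, …, yₙ`; the terms `λ y. Y` and `Lₖ` contain at most `x`, which is what makes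
the `η`-steps in `RightStructure` possible, the term substituted for `x` being closed. -/
def leafBody (Y : Term 2) (L : List (Term 1)) {n : ℕ} (Z : Fin n → Term (1 + n)) : Term 1 :=
  lams n (apps (weaken n (headPart Y L)) (List.ofFn Z))

/-- The term `λ y₁ … yₙ. ((λ y. Y) L₁ ⋯ Lₘ) y₁ ⋯ yₙ`. -/
def leafBodyEta (Y : Term 2) (L : List (Term 1)) (n : ℕ) : Term 1 :=
  lams n (apps (weaken n (headPart Y L)) (boundVars 1 n))

/-- A left reduction `(λ x. B) M ↠ H` that consists of the step to `[M/x]B`, followed by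
non-head `β`-reductions, followed by `η`-reductions. -/
def LeftStructure (B : Term 1) (M H : Term 0) : Prop :=
  ∃ K : Term 0, NonHeadRed (inst B M) K ∧ EtaRed K H

/-- A right reduction of the shape
`G N ↠ [N/x](λ y₁ … yₙ. ((λ y. Y) L₁ ⋯ Lₘ) Z₁ ⋯ Zₙ)`
`↠ λ y₁ … yₙ. ([N/x](λ y. Y) [N/x]L₁ ⋯ [N/x]Lₘ) y₁ ⋯ yₙ`
`↠ [N/x](λ y. Y) [N/x]L₁ ⋯ [N/x]Lₘ` (by `η`-steps) `↠ J₀ J₁ ⋯ Jₘ ↠ H`. -/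
def RightStructure (Y : Term 2) (L : List (Term 1)) {n : ℕ} (Z : Fin n → Term (1 + n))
    (N H : Term 0) : Prop :=
  BetaEtaRed (app (lam (leafBody Y L Z)) N) (inst (leafBody Y L Z) N) ∧
  BetaEtaRed (inst (leafBody Y L Z) N) (inst (leafBodyEta Y L n) N) ∧
  EtaRed (inst (leafBodyEta Y L n) N) (inst (headPart Y L) N) ∧
  ∃ (J₀ : Term 0) (J : List (Term 0)),
    IsNormalFormOrSelf (inst (lam Y) N) J₀ ∧
    List.Forall₂ (fun l j => IsNormalFormOrSelf (inst l N) j) L J ∧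
    BetaEtaRed (inst (headPart Y L) N) (apps J₀ J) ∧
    BetaEtaRed (apps J₀ J) H

/-- The conditions on a component `H ↞ G M = G N ↠ H'` of a canonical endpiece. -/
def CanonicalComponent (G M N H H' : Term 0) : Prop :=
  ∃ (Y : Term 2) (L : List (Term 1)) (n : ℕ) (Z : Fin n → Term (1 + n)),
    G = lam (leafBody Y L Z) ∧
    LeftStructure (leafBody Y L Z) M H ∧
    RightStructure Y L Z N H'

/-- `X`-canonical proofs. -/
def ProofTree.IsCanonical (X : Set (Term 0)) : {F F' : Term 0} → ProofTree F F' → Prop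
  | _, _, .omega prem => ∀ R, (prem R).IsCanonical X
  | _, _, .endpiece _ G M N H _ _ _ _ leaf =>
      (∀ i, H i ∈ X) ∧
      (∀ i, CanonicalComponent (G i) (M i) (N i) (H i.castSucc) (H i.succ)) ∧
      ∀ i R, (leaf i R).IsCanonical X

end LambdaOmega

/-!
Call an element of `X` settled if it is normal as soon as it has a normal form. For settled `H'`,
the term `G = λ x. λ y. x y` yields a canonical component `H ↞ G H = G H' ↠ H'` whenever all the
equations `H R = H' R` have canonical proofs. Hence having a canonical endpiece with settled
confluence terms is a transitive relation closed under the `ω`-rule.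

What remains is congruence: if `M = N` follows by the `ω`-rule, then `[M/x]C` and `[N/x]C` are
connected by a canonical endpiece. By standardization, a reduction of `[M/x]C` to a settled term
consists of head steps, then `β`-steps other than head steps, then `η`-steps. The head reduction is
lifted to `C`, where `x` is replaced by `M` whenever it reaches the head position. On the other side
this turns `N A R₁ ⋯ Rₖ` into `M A R₁ ⋯ Rₖ`, which is provably equal by the premise `M A = N A` of
the `ω`-rule and its congruence; beneath a binder, the `ω`-rule reduces this to closed instances.
The lifted head reduction ends in a term `(λ y. Y) L₁ ⋯ Lₘ`, and what is left of the reduction is of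
the form required on the left of a canonical component with `n = 0`.
-/

namespace LambdaOmega

/-! ### Substitution -/

namespace Term

/-- The renaming `f` under a binder. -/
def upr {m n : ℕ} (f : Fin m → Fin n) : Fin (m + 1) → Fin (n + 1) :=
  Fin.cases 0 fun i => (f i).succ

/-- The substitution `σ` under a binder. -/
def up {m n : ℕ} (σ : Fin m → Term n) : Fin (m + 1) → Term (n + 1) :=
  Fin.cases (var 0) fun i => rename Fin.succ (σ i)

/-- The substitution of `u` for the variable `0`, so that `inst t u` is `subst (single u) t`. -/
def single {n : ℕ} (u : Term n) : Fin (n + 1) → Term n := Fin.cases u var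

/-- The closed term `t` in a context of `n` variables. -/
def emb {n : ℕ} (t : Term 0) : Term n := rename Fin.elim0 t

section
variable {k m n : ℕ}

@[simp] theorem upr_zero (f : Fin m → Fin n) : upr f 0 = 0 := rfl
@[simp] theorem upr_succ (f : Fin m → Fin n) (i : Fin m) : upr f i.succ = (f i).succ := rfl
@[simp] theorem up_zero (σ : Fin m → Term n) : up σ 0 = var 0 := rfl
@[simp] theorem up_succ (σ : Fin m → Term n) (i : Fin m) :
    up σ i.succ = rename Fin.succ (σ i) := rfl

@[simp] theorem rename_var (f : Fin m → Fin n) (i : Fin m) : rename f (var i) = var (f i) := rfl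
@[simp] theorem rename_app (f : Fin m → Fin n) (s t : Term m) :
    rename f (app s t) = app (rename f s) (rename f t) := rfl
@[simp] theorem rename_lam (f : Fin m → Fin n) (t : Term (m + 1)) :
    rename f (lam t) = lam (rename (upr f) t) := rfl
@[simp] theorem subst_var (σ : Fin m → Term n) (i : Fin m) : subst σ (var i) = σ i := rfl
@[simp] theorem subst_app (σ : Fin m → Term n) (s t : Term m) :
    subst σ (app s t) = app (subst σ s) (subst σ t) := rfl
@[simp] theorem subst_lam (σ : Fin m → Term n) (t : Term (m + 1)) :
    subst σ (lam t) = lam (subst (up σ) t) := rfl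
@[simp] theorem inst_var_zero (u : Term n) : inst (var 0) u = u := rfl
@[simp] theorem inst_app (s t : Term (n + 1)) (u : Term n) :
    inst (app s t) u = app (inst s u) (inst t u) := rfl

theorem inst_eq_subst (t : Term (n + 1)) (u : Term n) : inst t u = subst (single u) t := rfl

theorem rename_rename (t : Term k) {m n : ℕ} (f : Fin k → Fin m) (g : Fin m → Fin n) :
    rename g (rename f t) = rename (g ∘ f) t := by
  induction t generalizing m n with
  | var i => rfl
  | app s t ihs iht => simp only [rename_app, ihs, iht]
  | lam t ih =>
    simp only [rename_lam, ih]
    congr 2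
    exact funext (Fin.forall_fin_succ.2 ⟨rfl, fun _ => rfl⟩)

theorem subst_rename (t : Term k) {m n : ℕ} (f : Fin k → Fin m) (σ : Fin m → Term n) :
    subst σ (rename f t) = subst (σ ∘ f) t := by
  induction t generalizing m n with
  | var i => rfl
  | app s t ihs iht => simp only [rename_app, subst_app, ihs, iht]
  | lam t ih =>
    simp only [rename_lam, subst_lam, ih]
    congr 2
    exact funext (Fin.forall_fin_succ.2 ⟨rfl, fun _ => rfl⟩)

theorem rename_upr_rename_succ (f : Fin m → Fin n) (t : Term m) :
    rename (upr f) (rename Fin.succ t) = rename Fin.succ (rename f t) := by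
  rw [rename_rename, rename_rename]; rfl

theorem rename_subst (t : Term k) {m n : ℕ} (σ : Fin k → Term m) (f : Fin m → Fin n) :
    rename f (subst σ t) = subst (fun i => rename f (σ i)) t := by
  induction t generalizing m n with
  | var i => rfl
  | app s t ihs iht => simp only [rename_app, subst_app, ihs, iht]
  | lam t ih =>
    simp only [rename_lam, subst_lam, ih]
    congr 2
    exact funext (Fin.forall_fin_succ.2 ⟨rfl, fun _ => rename_upr_rename_succ _ _⟩)

theorem subst_up_rename_succ (σ : Fin m → Term n) (t : Term m) :
    subst (up σ) (rename Fin.succ t) = rename Fin.succ (subst σ t) := by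
  rw [subst_rename, rename_subst]; rfl

theorem subst_subst (t : Term k) {m n : ℕ} (σ : Fin k → Term m) (τ : Fin m → Term n) :
    subst τ (subst σ t) = subst (fun i => subst τ (σ i)) t := by
  induction t generalizing m n with
  | var i => rfl
  | app s t ihs iht => simp only [subst_app, ihs, iht]
  | lam t ih =>
    simp only [subst_lam, ih]
    congr 2
    exact funext (Fin.forall_fin_succ.2 ⟨rfl, fun _ => subst_up_rename_succ _ _⟩)

theorem up_var_comp (f : Fin m → Fin n) : up (fun i => var (f i)) = fun i => var (upr f i) :=
  funext (Fin.forall_fin_succ.2 ⟨rfl, fun _ => rfl⟩)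

theorem up_var : up (var : Fin n → Term n) = var :=
  funext (Fin.forall_fin_succ.2 ⟨rfl, fun _ => rfl⟩)

@[simp] theorem subst_id (t : Term n) : subst var t = t := by
  induction t with
  | var i => rfl
  | app s t ihs iht => simp only [subst_app, ihs, iht]
  | lam t ih =>
    rw [subst_lam, up_var, ih]

theorem rename_eq_subst (f : Fin m → Fin n) (t : Term m) :
    rename f t = subst (fun i => var (f i)) t := by
  simpa only [subst_id, rename_var] using rename_subst t var f

@[simp] theorem inst_rename_succ (t : Term n) (u : Term n) : inst (rename Fin.succ t) u = t :=
  (subst_rename t Fin.succ (single u)).trans (subst_id t)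

theorem subst_inst (σ : Fin m → Term n) (t : Term (m + 1)) (u : Term m) :
    subst σ (inst t u) = inst (subst (up σ) t) (subst σ u) := by
  simp only [inst_eq_subst, subst_subst]
  congr 1
  exact funext (Fin.forall_fin_succ.2 ⟨rfl, fun _ => (inst_rename_succ _ _).symm⟩)

theorem rename_inst (f : Fin m → Fin n) (t : Term (m + 1)) (u : Term m) :
    rename f (inst t u) = inst (rename (upr f) t) (rename f u) := by
  simp only [rename_eq_subst, subst_inst, up_var_comp]

@[simp] theorem inst_rename_upr_succ (t : Term (n + 1)) :
    inst (rename (upr Fin.succ) t) (var 0) = t := by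
  rw [inst_eq_subst, subst_rename]
  convert subst_id t using 2
  exact funext (Fin.forall_fin_succ.2 ⟨rfl, fun _ => rfl⟩)

theorem exists_of_rename_eq_rename {s : Term m} {t : Term n} {f : Fin m → Fin k}
    {g : Fin n → Fin k} {l : ℕ} {p : Fin l → Fin m} {q : Fin l → Fin n}
    (hfg : ∀ i j, f i = g j → ∃ a, p a = i ∧ q a = j) (h : rename f s = rename g t) :
    ∃ u, s = rename p u ∧ t = rename q u := by
  induction s generalizing n k l with
  | var i =>
    cases t with
    | var j =>
      obtain ⟨a, rfl, rfl⟩ := hfg i j (Term.var.inj h)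
      exact ⟨var a, rfl, rfl⟩
    | _ => cases h
  | app s₁ s₂ ih₁ ih₂ =>
    cases t with
    | app t₁ t₂ =>
      obtain ⟨h₁, h₂⟩ := Term.app.inj h
      obtain ⟨u₁, rfl, rfl⟩ := ih₁ hfg h₁
      obtain ⟨u₂, rfl, rfl⟩ := ih₂ hfg h₂
      exact ⟨app u₁ u₂, rfl, rfl⟩
    | _ => cases h
  | lam s ih =>
    cases t with
    | lam t =>
      have hup : ∀ i j, upr f i = upr g j → ∃ a, upr p a = i ∧ upr q a = j := by
        simp only [Fin.forall_fin_succ, Fin.exists_fin_succ]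
        simpa [Fin.succ_ne_zero, (Fin.succ_ne_zero _).symm] using hfg
      obtain ⟨u, rfl, rfl⟩ := ih hup (Term.lam.inj h)
      exact ⟨lam u, rfl, rfl⟩
    | _ => cases h

theorem rename_injective {f : Fin m → Fin n} (hf : Function.Injective f) :
    Function.Injective (rename f) := by
  intro s t h
  obtain ⟨u, rfl, rfl⟩ := exists_of_rename_eq_rename (p := id) (q := id)
    (fun i j hij => ⟨i, rfl, hf hij⟩) h
  rfl

theorem exists_of_rename_upr_eq_rename_succ {f : Fin m → Fin n} {s : Term (m + 1)} {t : Term n}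
    (h : rename (upr f) s = rename Fin.succ t) :
    ∃ u, s = rename Fin.succ u ∧ t = rename f u := by
  refine exists_of_rename_eq_rename (fun i j hij => ?_) h
  cases i using Fin.cases with
  | zero => exact absurd hij (Fin.succ_ne_zero j).symm
  | succ i => exact ⟨i, rfl, Fin.succ_injective _ hij⟩

@[simp] theorem subst_emb (σ : Fin m → Term n) (t : Term 0) : subst σ (emb t) = emb t := by
  rw [emb, emb, subst_rename, rename_eq_subst]
  exact congrArg (subst · t) (Subsingleton.elim _ _)

@[simp] theorem rename_emb (f : Fin m → Fin n) (t : Term 0) : rename f (emb t) = emb t := by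
  rw [rename_eq_subst, subst_emb]

@[simp] theorem inst_emb (u : Term n) (t : Term 0) : inst (emb t) u = emb t := subst_emb _ _

@[simp] theorem subst_zero (σ : Fin 0 → Term 0) (t : Term 0) : subst σ t = t := by
  rw [Subsingleton.elim σ var, subst_id]

@[simp] theorem emb_zero (t : Term 0) : (emb t : Term 0) = t := by
  rw [emb, rename_eq_subst, subst_zero]

theorem inst_subst_up (σ : Fin m → Term n) (t : Term (m + 1)) (u : Term n) :
    inst (subst (up σ) t) u = subst (Fin.cases u σ) t := by
  rw [inst_eq_subst, subst_subst]
  congr 1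
  exact funext (Fin.forall_fin_succ.2 ⟨rfl, fun _ => inst_rename_succ _ _⟩)

theorem inst_inst (s t : Term 1) (u : Term 0) :
    inst s (inst t u) = inst (subst (fun _ => t) s) u := by
  simp only [inst_eq_subst, subst_subst]
  congr 1
  exact funext (Fin.forall_fin_one.2 rfl)

theorem subst_apps (σ : Fin m → Term n) (s : Term m) (ts : List (Term m)) :
    subst σ (apps s ts) = apps (subst σ s) (ts.map (subst σ)) := by
  induction ts generalizing s with
  | nil => rfl
  | cons t _ ih => exact ih (app s t)

theorem apps_append_singleton (s : Term n) (ts : List (Term n)) (t : Term n) :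
    apps s (ts ++ [t]) = app (apps s ts) t := by
  simp only [apps, List.foldl_append, List.foldl_cons, List.foldl_nil]

end

end Term

open Term

/-! ### Reduction -/

section
variable {m n : ℕ}

theorem Beta.subst {s t : Term m} (h : Beta s t) {n : ℕ} (σ : Fin m → Term n) :
    Beta (subst σ s) (subst σ t) := by
  induction h generalizing n with
  | beta t u => rw [subst_inst]; exact .beta _ _
  | appL t _ ih => exact .appL _ (ih σ)
  | appR s _ ih => exact .appR _ (ih σ)
  | lam _ ih => exact .lam (ih _)

theorem Eta.subst {s t : Term m} (h : Eta s t) {n : ℕ} (σ : Fin m → Term n) :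
    Eta (subst σ s) (subst σ t) := by
  induction h generalizing n with
  | eta t =>
    simp only [subst_lam, subst_app, subst_up_rename_succ, subst_var, up_zero]
    exact .eta _
  | appL t _ ih => exact .appL _ (ih σ)
  | appR s _ ih => exact .appR _ (ih σ)
  | lam _ ih => exact .lam (ih _)

theorem Eta.rename {s t : Term m} (h : Eta s t) (f : Fin m → Fin n) :
    Eta (rename f s) (rename f t) := by
  simpa only [rename_eq_subst] using h.subst _

theorem BetaEta.subst {s t : Term m} (h : BetaEta s t) (σ : Fin m → Term n) :
    BetaEta (subst σ s) (subst σ t) := h.imp (·.subst σ) (·.subst σ)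

theorem BetaEta.rename {s t : Term m} (h : BetaEta s t) (f : Fin m → Fin n) :
    BetaEta (rename f s) (rename f t) := by
  simpa only [rename_eq_subst] using h.subst _

theorem BetaEta.appL {s s' : Term n} (h : BetaEta s s') (t : Term n) :
    BetaEta (app s t) (app s' t) := h.imp (.appL t) (.appL t)

theorem BetaEta.appR {t t' : Term n} (s : Term n) (h : BetaEta t t') :
    BetaEta (app s t) (app s t') := h.imp (.appR s) (.appR s)

theorem BetaRed.app {s s' t t' : Term n} (h : BetaRed s s') (h' : BetaRed t t') :
    BetaRed (app s t) (app s' t') :=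
  (h.lift (Term.app · t) fun _ _ => .appL t).trans (h'.lift (Term.app s') fun _ _ => .appR s')

theorem BetaRed.lam {t t' : Term (n + 1)} (h : BetaRed t t') : BetaRed (lam t) (lam t') :=
  h.lift Term.lam fun _ _ => .lam

theorem EtaRed.app {s s' t t' : Term n} (h : EtaRed s s') (h' : EtaRed t t') :
    EtaRed (app s t) (app s' t') :=
  (h.lift (Term.app · t) fun _ _ => .appL t).trans (h'.lift (Term.app s') fun _ _ => .appR s')

theorem EtaRed.lam {t t' : Term (n + 1)} (h : EtaRed t t') : EtaRed (lam t) (lam t') :=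
  h.lift Term.lam fun _ _ => .lam

theorem EtaRed.rename {s t : Term m} (h : EtaRed s t) (f : Fin m → Fin n) :
    EtaRed (rename f s) (rename f t) := h.lift (Term.rename f) fun _ _ h => h.rename f

theorem EtaRed.up {σ τ : Fin m → Term n} (h : ∀ i, EtaRed (σ i) (τ i)) :
    ∀ i, EtaRed (up σ i) (up τ i) :=
  Fin.forall_fin_succ.2 ⟨.refl, fun i => (h i).rename _⟩

theorem EtaRed.subst_pointwise {m n : ℕ} (t : Term m) {σ τ : Fin m → Term n}
    (h : ∀ i, EtaRed (σ i) (τ i)) : EtaRed (subst σ t) (subst τ t) := by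
  induction t generalizing n with
  | var i => exact h i
  | app s t ihs iht => exact (ihs h).app (iht h)
  | lam t ih => exact (ih (EtaRed.up h)).lam

theorem EtaRed.inst (t : Term (n + 1)) {u u' : Term n} (h : EtaRed u u') :
    EtaRed (inst t u) (inst t u') :=
  .subst_pointwise t (Fin.forall_fin_succ.2 ⟨h, fun _ => .refl⟩)

theorem BetaRed.betaEtaRed {s t : Term n} (h : BetaRed s t) : BetaEtaRed s t :=
  ReflTransGen.mono (fun _ _ => Or.inl) _ _ h

theorem EtaRed.betaEtaRed {s t : Term n} (h : EtaRed s t) : BetaEtaRed s t :=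
  ReflTransGen.mono (fun _ _ => Or.inr) _ _ h

theorem BetaEtaRed.app {s s' t t' : Term n} (h : BetaEtaRed s s') (h' : BetaEtaRed t t') :
    BetaEtaRed (app s t) (app s' t') :=
  (h.lift (Term.app · t) fun _ _ h => h.appL t).trans
    (h'.lift (Term.app s') fun _ _ h => h.appR s')

theorem BetaEtaRed.subst {s t : Term m} (h : BetaEtaRed s t) (σ : Fin m → Term n) :
    BetaEtaRed (subst σ s) (subst σ t) := h.lift (Term.subst σ) fun _ _ h => h.subst σ

theorem Beta.exists_of_app {s t u : Term n} (h : Beta (app s t) u) :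
    (∃ v, s = .lam v ∧ u = inst v t) ∨ (∃ s', Beta s s' ∧ u = app s' t) ∨
      ∃ t', Beta t t' ∧ u = app s t' := by
  cases h with
  | beta v _ => exact .inl ⟨v, rfl, rfl⟩
  | appL _ h => exact .inr (.inl ⟨_, h, rfl⟩)
  | appR _ h => exact .inr (.inr ⟨_, h, rfl⟩)

theorem Beta.exists_of_lam {t : Term (n + 1)} {u : Term n} (h : Beta (.lam t) u) :
    ∃ t', Beta t t' ∧ u = .lam t' := by
  cases h with
  | lam h => exact ⟨_, h, rfl⟩

theorem Eta.exists_of_app {s t u : Term n} (h : Eta (app s t) u) :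
    (∃ s', Eta s s' ∧ u = app s' t) ∨ ∃ t', Eta t t' ∧ u = app s t' := by
  cases h with
  | appL _ h => exact .inl ⟨_, h, rfl⟩
  | appR _ h => exact .inr ⟨_, h, rfl⟩

theorem Eta.exists_of_lam {t : Term (n + 1)} {u : Term n} (h : Eta (.lam t) u) :
    t = app (Term.rename Fin.succ u) (var 0) ∨ ∃ t', Eta t t' ∧ u = .lam t' := by
  cases h with
  | eta _ => exact .inl rfl
  | lam h => exact .inr ⟨_, h, rfl⟩

theorem Beta.exists_of_rename {t : Term m} {f : Fin m → Fin n} {u : Term n}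
    (h : Beta (rename f t) u) : ∃ t', u = rename f t' ∧ Beta t t' := by
  induction t generalizing n with
  | var i => cases h
  | app s t ihs iht =>
    rcases Beta.exists_of_app h with ⟨v, hv, rfl⟩ | ⟨_, hs, rfl⟩ | ⟨_, ht, rfl⟩
    · cases s with
      | lam s =>
        obtain rfl := Term.lam.inj hv
        exact ⟨_, (rename_inst _ _ _).symm, .beta _ _⟩
      | _ => cases hv
    · obtain ⟨s', rfl, hs'⟩ := ihs hs
      exact ⟨app s' t, rfl, .appL _ hs'⟩
    · obtain ⟨t', rfl, ht'⟩ := iht ht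
      exact ⟨app s t', rfl, .appR _ ht'⟩
  | lam t ih =>
    obtain ⟨_, ht, rfl⟩ := Beta.exists_of_lam h
    obtain ⟨t', rfl, ht'⟩ := ih ht
    exact ⟨.lam t', rfl, .lam ht'⟩

theorem Term.exists_of_rename_upr_eq_etaRedex {f : Fin m → Fin n} {t : Term (m + 1)} {u : Term n}
    (h : rename (upr f) t = app (rename Fin.succ u) (var 0)) :
    ∃ v, t = app (rename Fin.succ v) (var 0) ∧ u = rename f v := by
  cases t with
  | app s t =>
    obtain ⟨hs, ht⟩ := Term.app.inj h
    obtain ⟨v, rfl, rfl⟩ := exists_of_rename_upr_eq_rename_succ hs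
    cases t with
    | var i =>
      cases i using Fin.cases with
      | zero => exact ⟨v, rfl, rfl⟩
      | succ i => exact absurd (Term.var.inj ht) (Fin.succ_ne_zero _)
    | _ => cases ht
  | _ => cases h

theorem Eta.exists_of_rename {t : Term m} {f : Fin m → Fin n} {u : Term n}
    (h : Eta (Term.rename f t) u) : ∃ t', u = Term.rename f t' ∧ Eta t t' := by
  induction t generalizing n with
  | var i => cases h
  | app s t ihs iht =>
    rcases Eta.exists_of_app h with ⟨_, hs, rfl⟩ | ⟨_, ht, rfl⟩
    · obtain ⟨s', rfl, hs'⟩ := ihs hs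
      exact ⟨.app s' t, rfl, .appL _ hs'⟩
    · obtain ⟨t', rfl, ht'⟩ := iht ht
      exact ⟨.app s t', rfl, .appR _ ht'⟩
  | lam t ih =>
    rcases Eta.exists_of_lam h with h | ⟨_, ht, rfl⟩
    · obtain ⟨v, rfl, rfl⟩ := exists_of_rename_upr_eq_etaRedex h
      exact ⟨v, rfl, .eta v⟩
    · obtain ⟨t', rfl, ht'⟩ := ih ht
      exact ⟨.lam t', rfl, .lam ht'⟩

end

/-! ### Confluence -/

/-- Parallel `β`-reduction. -/
inductive Par : {n : ℕ} → Term n → Term n → Prop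
  | var {n : ℕ} (i : Fin n) : Par (var i) (var i)
  | app {n : ℕ} {s s' t t' : Term n} : Par s s' → Par t t' → Par (app s t) (app s' t')
  | lam {n : ℕ} {t t' : Term (n + 1)} : Par t t' → Par (lam t) (lam t')
  | beta {n : ℕ} {s s' : Term (n + 1)} {t t' : Term n} : Par s s' → Par t t' →
      Par (app (lam s) t) (inst s' t')

/-- Takahashi's complete development: the contraction of all `β`-redexes of a term. -/
def Term.development : {n : ℕ} → Term n → Term n
  | _, var i => var i
  | _, app (lam s) t => inst (development s) (development t)
  | _, app s t => app (development s) (development t)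
  | _, lam t => lam (development t)

theorem reflGen_lift {α β : Type*} {r : α → α → Prop} {p : β → β → Prop}
    (f : α → β) (h : ∀ a b, r a b → p (f a) (f b)) {a b : α} (hab : ReflGen r a b) :
    ReflGen p (f a) (f b) := by
  cases hab with
  | refl => exact .refl
  | single hab => exact .single (h _ _ hab)

section
variable {m n : ℕ}

theorem Par.refl (t : Term n) : Par t t := by
  induction t with
  | var i => exact .var i
  | app s t ihs iht => exact .app ihs iht
  | lam t ih => exact .lam ih

theorem Par.rename {s t : Term m} (h : Par s t) {n : ℕ} (f : Fin m → Fin n) :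
    Par (rename f s) (rename f t) := by
  induction h generalizing n with
  | var i => exact .refl _
  | app _ _ ih₁ ih₂ => exact .app (ih₁ f) (ih₂ f)
  | lam _ ih => exact .lam (ih _)
  | beta _ _ ih₁ ih₂ => rw [rename_inst]; exact .beta (ih₁ _) (ih₂ f)

theorem Par.up {σ τ : Fin m → Term n} (h : ∀ i, Par (σ i) (τ i)) : ∀ i, Par (up σ i) (up τ i) :=
  Fin.forall_fin_succ.2 ⟨.refl _, fun i => (h i).rename _⟩

theorem Par.subst {s t : Term m} (h : Par s t) {n : ℕ} {σ τ : Fin m → Term n}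
    (hστ : ∀ i, Par (σ i) (τ i)) : Par (subst σ s) (subst τ t) := by
  induction h generalizing n with
  | var i => exact hστ i
  | app _ _ ih₁ ih₂ => exact .app (ih₁ hστ) (ih₂ hστ)
  | lam _ ih => exact .lam (ih (Par.up hστ))
  | beta _ _ ih₁ ih₂ => rw [subst_inst]; exact .beta (ih₁ (Par.up hστ)) (ih₂ hστ)

theorem Par.inst {s s' : Term (n + 1)} {t t' : Term n} (h : Par s s') (h' : Par t t') :
    Par (inst s t) (inst s' t') :=
  h.subst (Fin.forall_fin_succ.2 ⟨h', fun _ => .refl _⟩)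

theorem Par.par_development {s t : Term n} (h : Par s t) : Par t s.development := by
  induction h with
  | var i => exact .var i
  | lam _ ih => exact .lam ih
  | beta _ _ ih₁ ih₂ => exact ih₁.inst ih₂
  | @app _ s s' t t' h₁ _ ih₁ ih₂ =>
    cases s with
    | lam s =>
      cases h₁ with
      | lam _ => cases ih₁ with
        | lam ih₁ => exact .beta ih₁ ih₂
    | var i => exact .app ih₁ ih₂
    | app s₁ s₂ => exact .app ih₁ ih₂

theorem Beta.par {s t : Term n} (h : Beta s t) : Par s t := by
  induction h with
  | beta t u => exact .beta (.refl _) (.refl _)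
  | appL t _ ih => exact .app ih (.refl _)
  | appR s _ ih => exact .app (.refl _) ih
  | lam _ ih => exact .lam ih

theorem Par.betaRed {s t : Term n} (h : Par s t) : BetaRed s t := by
  induction h with
  | var i => exact .refl
  | app _ _ ih₁ ih₂ => exact ih₁.app ih₂
  | lam _ ih => exact ih.lam
  | beta _ _ ih₁ ih₂ => exact (ih₁.lam.app ih₂).tail (.beta _ _)

theorem reflTransGen_par : ReflTransGen (Par (n := n)) = BetaRed := by
  refine le_antisymm (reflTransGen_closed fun _ _ => Par.betaRed) ?_
  exact ReflTransGen.mono fun _ _ => Beta.par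

theorem BetaRed.confluent {s t u : Term n} (h : BetaRed s t) (h' : BetaRed s u) :
    Join BetaRed t u := by
  rw [← reflTransGen_par] at h h' ⊢
  exact church_rosser (fun _ _ _ h h' =>
    ⟨_, .single h.par_development, .single h'.par_development⟩) h h'

theorem Eta.exists_of_etaRedex {t : Term n} {u : Term (n + 1)}
    (h : Eta (app (Term.rename Fin.succ t) (var 0)) u) :
    ∃ t', u = app (Term.rename Fin.succ t') (var 0) ∧ Eta t t' := by
  rcases Eta.exists_of_app h with ⟨_, hs, rfl⟩ | ⟨_, ht, rfl⟩
  · obtain ⟨t', rfl, ht'⟩ := Eta.exists_of_rename hs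
    exact ⟨t', rfl, ht'⟩
  · cases ht

theorem Beta.exists_of_etaRedex {t : Term n} {u : Term (n + 1)}
    (h : Beta (app (rename Fin.succ t) (var 0)) u) :
    Term.lam u = t ∨ ∃ t', u = app (rename Fin.succ t') (var 0) ∧ Beta t t' := by
  rcases Beta.exists_of_app h with ⟨v, hv, rfl⟩ | ⟨_, hs, rfl⟩ | ⟨_, ht, rfl⟩
  · cases t with
    | lam t =>
      obtain rfl := Term.lam.inj hv
      exact .inl (congrArg Term.lam (inst_rename_upr_succ t))
    | _ => cases hv
  · obtain ⟨t', rfl, ht'⟩ := Beta.exists_of_rename hs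
    exact .inr ⟨t', rfl, ht'⟩
  · cases ht

theorem Eta.subcommute {s t u : Term n} (h : Eta s t) (h' : Eta s u) :
    ∃ v, ReflGen Eta t v ∧ ReflGen Eta u v := by
  induction h with
  | eta t =>
    rcases Eta.exists_of_lam h' with h | ⟨w, hw, rfl⟩
    · obtain rfl := rename_injective (Fin.succ_injective _) (Term.app.inj h).1
      exact ⟨_, .refl, .refl⟩
    · obtain ⟨t', rfl, ht⟩ := hw.exists_of_etaRedex
      exact ⟨t', .single ht, .single (.eta t')⟩
  | appL t h ih =>
    rcases Eta.exists_of_app h' with ⟨s', hs, rfl⟩ | ⟨t', ht, rfl⟩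
    · obtain ⟨v, hv, hv'⟩ := ih hs
      exact ⟨_, reflGen_lift (Term.app · t) (fun _ _ => .appL t) hv,
        reflGen_lift (Term.app · t) (fun _ _ => .appL t) hv'⟩
    · exact ⟨_, .single (.appR _ ht), .single (.appL _ h)⟩
  | appR s h ih =>
    rcases Eta.exists_of_app h' with ⟨s', hs, rfl⟩ | ⟨t', ht, rfl⟩
    · exact ⟨_, .single (.appL _ hs), .single (.appR _ h)⟩
    · obtain ⟨v, hv, hv'⟩ := ih ht
      exact ⟨_, reflGen_lift (Term.app s) (fun _ _ => .appR s) hv,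
        reflGen_lift (Term.app s) (fun _ _ => .appR s) hv'⟩
  | lam h ih =>
    rcases Eta.exists_of_lam h' with rfl | ⟨w, hw, rfl⟩
    · obtain ⟨t', rfl, ht⟩ := h.exists_of_etaRedex
      exact ⟨t', .single (.eta t'), .single ht⟩
    · obtain ⟨v, hv, hv'⟩ := ih hw
      exact ⟨_, reflGen_lift Term.lam (fun _ _ => .lam) hv,
        reflGen_lift Term.lam (fun _ _ => .lam) hv'⟩

theorem EtaRed.confluent {s t u : Term n} (h : EtaRed s t) (h' : EtaRed s u) :
    Join EtaRed t u :=
  church_rosser (fun _ _ _ h h' =>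
    (h.subcommute h').imp fun _ => And.imp_right ReflGen.to_reflTransGen) h h'

theorem Eta.commute_beta {s t u : Term n} (h : Eta s t) (h' : Beta s u) :
    ∃ v, ReflGen Beta t v ∧ EtaRed u v := by
  induction h with
  | eta t =>
    obtain ⟨w, hw, rfl⟩ := Beta.exists_of_lam h'
    rcases hw.exists_of_etaRedex with rfl | ⟨t', rfl, ht⟩
    · exact ⟨_, .refl, .refl⟩
    · exact ⟨t', .single ht, .single (.eta t')⟩
  | @appL _ s s' t h ih =>
    rcases Beta.exists_of_app h' with ⟨v, rfl, rfl⟩ | ⟨s'', hs, rfl⟩ | ⟨t', ht, rfl⟩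
    · rcases Eta.exists_of_lam h with rfl | ⟨v', hv, rfl⟩
      · refine ⟨_, .refl, ?_⟩
        rw [inst_app, inst_rename_succ, inst_var_zero]
        exact .refl
      · exact ⟨_, .single (.beta _ _), .single (hv.subst _)⟩
    · obtain ⟨v, hv, hv'⟩ := ih hs
      exact ⟨_, reflGen_lift (Term.app · t) (fun _ _ => .appL t) hv, hv'.app .refl⟩
    · exact ⟨_, .single (.appR _ ht), .single (.appL _ h)⟩
  | appR s h ih =>
    rcases Beta.exists_of_app h' with ⟨v, rfl, rfl⟩ | ⟨s', hs, rfl⟩ | ⟨t', ht, rfl⟩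
    · exact ⟨_, .single (.beta _ _), EtaRed.inst v (.single h)⟩
    · exact ⟨_, .single (.appL _ hs), .single (.appR _ h)⟩
    · obtain ⟨v, hv, hv'⟩ := ih ht
      exact ⟨_, reflGen_lift (Term.app s) (fun _ _ => .appR s) hv, EtaRed.app .refl hv'⟩
  | lam _ ih =>
    obtain ⟨w, hw, rfl⟩ := Beta.exists_of_lam h'
    obtain ⟨v, hv, hv'⟩ := ih hw
    exact ⟨_, reflGen_lift Term.lam (fun _ _ => .lam) hv, hv'.lam⟩

end

theorem commute_reflTransGen {α : Type*} {r p : α → α → Prop}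
    (h : ∀ a b c, r a b → p a c → ∃ d, ReflGen p b d ∧ ReflTransGen r c d) {a b c : α}
    (hab : ReflTransGen r a b) (hac : ReflTransGen p a c) :
    ∃ d, ReflTransGen p b d ∧ ReflTransGen r c d := by
  have strip {a b c : α} (hac : p a c) (hab : ReflTransGen r a b) :
      ∃ d, ReflGen p b d ∧ ReflTransGen r c d := by
    induction hab with
    | refl => exact ⟨c, .single hac, .refl⟩
    | tail _ hbb' ih =>
      obtain ⟨d, hbd, hcd⟩ := ih
      cases hbd with
      | refl => exact ⟨_, .refl, hcd.tail hbb'⟩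
      | single hbd =>
        obtain ⟨e, hb'e, hde⟩ := h _ _ _ hbb' hbd
        exact ⟨e, hb'e, hcd.trans hde⟩
  induction hac with
  | refl => exact ⟨b, .refl, hab⟩
  | tail _ hcc' ih =>
    obtain ⟨d, hbd, hcd⟩ := ih
    obtain ⟨e, hde, hc'e⟩ := strip hcc' hcd
    exact ⟨e, hbd.trans hde.to_reflTransGen, hc'e⟩

section
variable {n : ℕ}

theorem EtaRed.commute {s t u : Term n} (h : EtaRed s t) (h' : BetaRed s u) :
    ∃ v, BetaRed t v ∧ EtaRed u v :=
  commute_reflTransGen (fun _ _ _ => Eta.commute_beta) h h'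

theorem reflTransGen_betaRed_or_etaRed :
    ReflTransGen (fun s t : Term n => BetaRed s t ∨ EtaRed s t) = BetaEtaRed := by
  refine le_antisymm (reflTransGen_closed fun _ _ h => ?_) ?_
  · exact h.elim BetaRed.betaEtaRed EtaRed.betaEtaRed
  · exact ReflTransGen.mono fun _ _ h => h.imp .single .single

theorem BetaEtaRed.confluent {s t u : Term n} (h : BetaEtaRed s t) (h' : BetaEtaRed s u) :
    Join BetaEtaRed t u := by
  rw [← reflTransGen_betaRed_or_etaRed] at h h' ⊢
  refine church_rosser (fun a b c hab hac => ?_) h h'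
  suffices ∃ d, (BetaRed b d ∨ EtaRed b d) ∧ (BetaRed c d ∨ EtaRed c d) from
    this.imp fun _ => .imp .single .single
  rcases hab with hab | hab <;> rcases hac with hac | hac
  · exact (hab.confluent hac).imp fun _ => .imp .inl .inl
  · exact (hac.commute hab).imp fun _ h => ⟨.inr h.2, .inl h.1⟩
  · exact (hab.commute hac).imp fun _ => .imp .inl .inr
  · exact (hab.confluent hac).imp fun _ => .imp .inr .inr

theorem BetaEtaConv.join {s t : Term n} (h : BetaEtaConv s t) : Join BetaEtaRed s t :=
  (equivalence_join (r := ReflTransGen BetaEta) fun _ _ _ => BetaEtaRed.confluent).eqvGen_iff.1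
    (EqvGen.mono (fun _ t h => ⟨t, .single h, .refl⟩) _ _ h)

end

/-! ### Standardization -/

/-- One step of weak head reduction. -/
inductive Wh : {n : ℕ} → Term n → Term n → Prop
  | beta {n : ℕ} (t : Term (n + 1)) (u : Term n) : Wh (app (lam t) u) (inst t u)
  | appL {n : ℕ} {s s' : Term n} (t : Term n) : Wh s s' → Wh (app s t) (app s' t)

/-- Weak head reduction in any number of steps. -/
def WhRed {n : ℕ} (s t : Term n) : Prop := ReflTransGen Wh s t

/-- Standard `βη`-reductions: weak head reduction followed by standard reductions of the
immediate subterms, where an abstraction may be contracted by a final `η`-step. -/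
inductive Standard : {n : ℕ} → Term n → Term n → Prop
  | var {n : ℕ} {a : Term n} {i : Fin n} : WhRed a (var i) → Standard a (var i)
  | lam {n : ℕ} {a : Term n} {b t : Term (n + 1)} :
      WhRed a (lam b) → Standard b t → Standard a (lam t)
  | app {n : ℕ} {a b c s t : Term n} :
      WhRed a (app b c) → Standard b s → Standard c t → Standard a (app s t)
  | eta {n : ℕ} {a t : Term n} {b : Term (n + 1)} :
      WhRed a (lam b) → Standard b (app (rename Fin.succ t) (.var 0)) → Standard a t

/-- Contraction of a `β`-redex other than the weak head redex. -/
inductive Internal : {n : ℕ} → Term n → Term n → Prop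
  | lam {n : ℕ} {t t' : Term (n + 1)} : Beta t t' → Internal (lam t) (lam t')
  | appR {n : ℕ} (s : Term n) {t t' : Term n} : Beta t t' → Internal (app s t) (app s t')
  | appL {n : ℕ} {s s' : Term n} (t : Term n) : Internal s s' → Internal (app s t) (app s' t)

/-- Head reduction: weak head reduction, continued in the body of the abstraction reached. -/
inductive HeadRed : {n : ℕ} → Term n → Term n → Prop
  | wh {n : ℕ} {s t : Term n} : WhRed s t → HeadRed s t
  | lam {n : ℕ} {s : Term n} {t t' : Term (n + 1)} :
      WhRed s (lam t) → HeadRed t t' → HeadRed s (lam t')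

section
variable {m n : ℕ}

theorem Wh.beta_step {s t : Term n} (h : Wh s t) : Beta s t := by
  induction h with
  | beta t u => exact .beta t u
  | appL t _ ih => exact .appL t ih

theorem Wh.subst {s t : Term m} (h : Wh s t) (σ : Fin m → Term n) :
    Wh (subst σ s) (subst σ t) := by
  induction h with
  | beta t u => rw [subst_inst]; exact .beta _ _
  | appL t _ ih => exact .appL _ ih

theorem WhRed.betaRed {s t : Term n} (h : WhRed s t) : BetaRed s t :=
  ReflTransGen.mono (fun _ _ => Wh.beta_step) _ _ h

theorem WhRed.subst {s t : Term m} (h : WhRed s t) (σ : Fin m → Term n) :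
    WhRed (subst σ s) (subst σ t) := h.lift (Term.subst σ) fun _ _ h => h.subst σ

theorem WhRed.rename {s t : Term m} (h : WhRed s t) (f : Fin m → Fin n) :
    WhRed (rename f s) (rename f t) := by
  simpa only [rename_eq_subst] using h.subst _

theorem WhRed.app {s s' : Term n} (h : WhRed s s') (t : Term n) : WhRed (app s t) (app s' t) :=
  h.lift (Term.app · t) fun _ _ => .appL t

namespace Standard

theorem refl (t : Term n) : Standard t t := by
  induction t with
  | var i => exact .var .refl
  | app s t ihs iht => exact .app .refl ihs iht
  | lam t ih => exact .lam .refl ih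

theorem head {a b t : Term n} (h : WhRed a b) (h' : Standard b t) : Standard a t := by
  cases h' with
  | var h₁ => exact .var (h.trans h₁)
  | lam h₁ h₂ => exact .lam (h.trans h₁) h₂
  | app h₁ h₂ h₃ => exact .app (h.trans h₁) h₂ h₃
  | eta h₁ h₂ => exact .eta (h.trans h₁) h₂

theorem rename {a t : Term m} (h : Standard a t) {n : ℕ} (f : Fin m → Fin n) :
    Standard (rename f a) (rename f t) := by
  induction h generalizing n with
  | var h => exact .var (h.rename f)
  | lam h _ ih => exact .lam (h.rename f) (ih _)
  | app h _ _ ih₁ ih₂ => exact .app (h.rename f) (ih₁ f) (ih₂ f)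
  | eta h _ ih =>
    have := ih (upr f)
    rw [rename_app, rename_upr_rename_succ] at this
    exact .eta (h.rename f) this

theorem up {σ τ : Fin m → Term n} (h : ∀ i, Standard (σ i) (τ i)) :
    ∀ i, Standard (up σ i) (up τ i) :=
  Fin.forall_fin_succ.2 ⟨refl _, fun i => (h i).rename _⟩

theorem subst {a t : Term m} (h : Standard a t) {n : ℕ} {σ τ : Fin m → Term n}
    (hστ : ∀ i, Standard (σ i) (τ i)) : Standard (subst σ a) (subst τ t) := by
  induction h generalizing n with
  | var h => exact (hστ _).head (h.subst σ)
  | lam h _ ih => exact .lam (h.subst σ) (ih (up hστ))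
  | app h _ _ ih₁ ih₂ => exact .app (h.subst σ) (ih₁ hστ) (ih₂ hστ)
  | eta h _ ih =>
    have := ih (up hστ)
    rw [subst_app, subst_up_rename_succ] at this
    exact .eta (h.subst σ) this

theorem inst {a t : Term (n + 1)} {b u : Term n} (h : Standard a t) (h' : Standard b u) :
    Standard (inst a b) (inst t u) :=
  h.subst (Fin.forall_fin_succ.2 ⟨h', fun _ => refl _⟩)

/-- The two claims are proved together because a final `η`-step may create an abstraction. -/
theorem step_and_exists_of_lam {a t : Term n} (h : Standard a t) :
    (∀ t', BetaEta t t' → Standard a t') ∧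
      ∀ t₀, t = .lam t₀ → ∃ b, WhRed a (.lam b) ∧ Standard b t₀ := by
  induction h with
  | var _ =>
    refine ⟨fun t' ht => ?_, fun _ h => nomatch h⟩
    rcases ht with ht | ht <;> cases ht
  | lam h hs ih =>
    refine ⟨fun t' ht => ?_, fun t₀ e => ?_⟩
    · rcases ht with ht | ht
      · obtain ⟨_, hu, rfl⟩ := Beta.exists_of_lam ht
        exact .lam h (ih.1 _ (.inl hu))
      · rcases Eta.exists_of_lam ht with rfl | ⟨_, hu, rfl⟩
        · exact .eta h hs
        · exact .lam h (ih.1 _ (.inr hu))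
    · cases e
      exact ⟨_, h, hs⟩
  | app h hs₁ hs₂ ih₁ ih₂ =>
    refine ⟨fun t' ht => ?_, fun _ h => nomatch h⟩
    rcases ht with ht | ht
    · rcases Beta.exists_of_app ht with ⟨v, rfl, rfl⟩ | ⟨_, hu, rfl⟩ | ⟨_, hu, rfl⟩
      · obtain ⟨b, hb, hbv⟩ := ih₁.2 _ rfl
        exact (hbv.inst hs₂).head ((h.trans (hb.app _)).tail (.beta _ _))
      · exact .app h (ih₁.1 _ (.inl hu)) hs₂
      · exact .app h hs₁ (ih₂.1 _ (.inl hu))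
    · rcases Eta.exists_of_app ht with ⟨_, hu, rfl⟩ | ⟨_, hu, rfl⟩
      · exact .app h (ih₁.1 _ (.inr hu)) hs₂
      · exact .app h hs₁ (ih₂.1 _ (.inr hu))
  | eta h hs ih =>
    refine ⟨fun t' ht => .eta h (ih.1 _ ((ht.rename _).appL _)), ?_⟩
    rintro t₀ rfl
    have hβ : Beta (.app (.lam (Term.rename (upr Fin.succ) t₀)) (.var 0)) t₀ := by
      simpa only [inst_rename_upr_succ] using Beta.beta (Term.rename (upr Fin.succ) t₀) (.var 0)
    exact ⟨_, h, ih.1 _ (.inl hβ)⟩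

end Standard

theorem BetaEtaRed.standard {s t : Term n} (h : BetaEtaRed s t) : Standard s t := by
  induction h with
  | refl => exact .refl s
  | tail _ h ih => exact ih.step_and_exists_of_lam.1 _ h

theorem Internal.beta_step {s t : Term n} (h : Internal s t) : Beta s t := by
  induction h with
  | lam h => exact .lam h
  | appR s h => exact .appR s h
  | appL t _ ih => exact .appL t ih

theorem WhRed.trans_internal {s t u : Term n} (h : WhRed s t) (h' : ReflTransGen Internal t u) :
    BetaRed s u :=
  h.betaRed.trans (ReflTransGen.mono (fun _ _ => Internal.beta_step) _ _ h')

theorem Standard.exists_whRed_internal_etaRed {s t : Term n} (h : Standard s t) :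
    ∃ a b, WhRed s a ∧ ReflTransGen Internal a b ∧ EtaRed b t := by
  induction h with
  | var h => exact ⟨_, _, h, .refl, .refl⟩
  | lam h _ ih =>
    obtain ⟨a, b, h₁, h₂, h₃⟩ := ih
    exact ⟨_, _, h, (h₁.trans_internal h₂).lift Term.lam fun _ _ => .lam, h₃.lam⟩
  | app h _ _ ih₁ ih₂ =>
    obtain ⟨a, b, h₁, h₂, h₃⟩ := ih₁
    obtain ⟨a', b', h₁', h₂', h₃'⟩ := ih₂
    have hR := (h₁'.trans_internal h₂').lift (Term.app b) fun _ _ => Internal.appR b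
    exact ⟨_, _, h.trans (h₁.app _),
      (h₂.lift (Term.app · _) fun _ _ => Internal.appL _).trans hR, h₃.app h₃'⟩
  | eta h _ ih =>
    obtain ⟨a, b, h₁, h₂, h₃⟩ := ih
    exact ⟨_, _, h, (h₁.trans_internal h₂).lift Term.lam fun _ _ => .lam, h₃.lam.tail (.eta _)⟩

theorem Internal.nonHeadBeta_app {s s' : Term n} (h : Internal s s') (t : Term n) :
    NonHeadBeta (app s t) (app s' t) := by
  induction h generalizing t with
  | lam h => exact .appLam t h
  | appR s h => exact .appL t (.appR s h)
  | appL u _ ih => exact .appL t (ih u)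

theorem Standard.exists_headRed_nonHeadRed_etaRed {s t : Term n} (h : Standard s t) :
    ∃ a b, HeadRed s a ∧ NonHeadRed a b ∧ EtaRed b t := by
  induction h with
  | var h => exact ⟨_, _, .wh h, .refl, .refl⟩
  | lam h _ ih =>
    obtain ⟨a, b, h₁, h₂, h₃⟩ := ih
    exact ⟨_, _, .lam h h₁, h₂.lift Term.lam fun _ _ => .lam, h₃.lam⟩
  | app h hs ht _ _ =>
    obtain ⟨a, b, h₁, h₂, h₃⟩ := hs.exists_whRed_internal_etaRed
    obtain ⟨a', b', h₁', h₂', h₃'⟩ := ht.exists_whRed_internal_etaRed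
    have hR := (h₁'.trans_internal h₂').lift (Term.app b) fun _ _ => NonHeadBeta.appR b
    exact ⟨_, _, .wh (h.trans (h₁.app _)),
      (h₂.lift (Term.app · _) fun _ _ h => h.nonHeadBeta_app _).trans hR, h₃.app h₃'⟩
  | eta h _ ih =>
    obtain ⟨a, b, h₁, h₂, h₃⟩ := ih
    exact ⟨_, _, .lam h h₁, h₂.lift Term.lam fun _ _ => .lam, h₃.lam.tail (.eta _)⟩

end

/-! ### Canonical components -/

/-- The existence of a `βη`-normal form. -/
def HasNormalForm {n : ℕ} (t : Term n) : Prop := ∃ K, BetaEtaRed t K ∧ IsNormal K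

/-- The elements of `X` that are normal unless they have no normal form. Only these are used as
confluence terms, since the canonical right reductions normalize whatever has a normal form. -/
def settled (X : Set (Term 0)) : Set (Term 0) := {H ∈ X | HasNormalForm H → IsNormal H}

section
variable {n : ℕ}

theorem IsNormal.eq_of_betaEtaRed {t u : Term n} (ht : IsNormal t) (h : BetaEtaRed t u) :
    u = t := by
  rcases h.cases_head with rfl | ⟨v, hv, _⟩
  · rfl
  · exact absurd hv (ht v)

theorem HasNormalForm.of_betaEtaRed {t u : Term n} (h : HasNormalForm u) (htu : BetaEtaRed t u) :
    HasNormalForm t :=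
  h.imp fun _ hK => ⟨htu.trans hK.1, hK.2⟩

theorem Cofinal.settled {X : Set (Term 0)} (hX : Cofinal X) : Cofinal (settled X) := by
  intro M
  by_cases hM : HasNormalForm M
  · obtain ⟨K, hMK, hK⟩ := hM
    obtain ⟨H, hH, hKH⟩ := hX K
    obtain rfl := hK.eq_of_betaEtaRed hKH
    exact ⟨H, ⟨hH, fun _ => hK⟩, hMK⟩
  · obtain ⟨H, hH, hMH⟩ := hX M
    exact ⟨H, ⟨hH, fun h => absurd (h.of_betaEtaRed hMH) hM⟩, hMH⟩

theorem exists_isNormalFormOrSelf (A : Term n) : ∃ J, IsNormalFormOrSelf A J ∧ BetaEtaRed A J := by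
  by_cases h : HasNormalForm A
  · obtain ⟨J, hAJ, hJ⟩ := h
    exact ⟨J, .inl ⟨hAJ, hJ⟩, hAJ⟩
  · exact ⟨A, .inr ⟨h, rfl⟩, .refl⟩

theorem inst_headPart (Y : Term 2) (L : List (Term 1)) (N : Term 0) :
    inst (headPart Y L) N = apps (inst (lam Y) N) (L.map (inst · N)) := subst_apps _ _ _

theorem leafBody_zero (Y : Term 2) (L : List (Term 1)) (Z : Fin 0 → Term (1 + 0)) :
    leafBody Y L Z = headPart Y L := by
  rw [leafBody, List.ofFn_zero]
  exact (rename_eq_subst _ _).trans (subst_id _)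

theorem leafBodyEta_zero (Y : Term 2) (L : List (Term 1)) :
    leafBodyEta Y L 0 = headPart Y L := by
  rw [leafBodyEta, boundVars, List.ofFn_zero]
  exact (rename_eq_subst _ _).trans (subst_id _)

theorem BetaEtaRed.apps_map {α : Type*} {f g : α → Term n} (h : ∀ a, BetaEtaRed (f a) (g a))
    (l : List α) {s s' : Term n} (hs : BetaEtaRed s s') :
    BetaEtaRed (apps s (l.map f)) (apps s' (l.map g)) := by
  induction l generalizing s s' with
  | nil => exact hs
  | cons a _ ih => exact ih (hs.app (h a))

theorem canonicalComponent_headPart {Y : Term 2} {L : List (Term 1)} {M N H H' J₀ : Term 0}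
    {J : List (Term 0)} (hM : LeftStructure (headPart Y L) M H)
    (hJ₀ : IsNormalFormOrSelf (inst (lam Y) N) J₀)
    (hJ : List.Forall₂ (fun l j => IsNormalFormOrSelf (inst l N) j) L J)
    (hN : BetaEtaRed (inst (headPart Y L) N) (apps J₀ J)) (hH' : BetaEtaRed (apps J₀ J) H') :
    CanonicalComponent (lam (headPart Y L)) M N H H' := by
  refine ⟨Y, L, 0, Fin.elim0, ?_, ?_, ?_⟩
  · rw [leafBody_zero]
  · rwa [leafBody_zero]
  · rw [RightStructure, leafBody_zero, leafBodyEta_zero]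
    exact ⟨.single (.inl (.beta _ _)), .refl, .refl, J₀, J, hJ₀, hJ, hN, hH'⟩

theorem Cofinal.exists_canonicalComponent {X : Set (Term 0)} (hX : Cofinal X) {Y : Term 2}
    {L : List (Term 1)} {M H : Term 0} (hM : LeftStructure (headPart Y L) M H) (N : Term 0) :
    ∃ H' ∈ X, BetaEtaRed (inst (headPart Y L) N) H' ∧
      CanonicalComponent (lam (headPart Y L)) M N H H' := by
  choose nf hnf hred using exists_isNormalFormOrSelf (n := 0)
  have hN : BetaEtaRed (inst (headPart Y L) N)
      (apps (nf (inst (lam Y) N)) (L.map fun l => nf (inst l N))) := by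
    rw [inst_headPart]
    exact .apps_map (fun _ => hred _) L (hred _)
  obtain ⟨H', hH', hr⟩ := hX (apps (nf (inst (lam Y) N)) (L.map fun l => nf (inst l N)))
  exact ⟨H', hH', hN.trans hr, canonicalComponent_headPart hM (hnf _)
    (List.forall₂_map_right_iff.2 (List.forall₂_same.2 fun _ _ => hnf _)) hN hr⟩

/-- Both sides `λ y. H y` and `λ y. H' y` `η`-reduce to the desired confluence terms. -/
theorem canonicalComponent_eta (H : Term 0) {H' : Term 0} (hH' : HasNormalForm H' → IsNormal H') :
    CanonicalComponent (lam (headPart (app (var 1) (var 0)) [])) H H' H H' := by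
  have hη (A : Term 0) : Eta (inst (headPart (app (var 1) (var 0)) []) A) A := Eta.eta A
  have hM : LeftStructure (headPart (app (var 1) (var 0)) []) H H := ⟨_, .refl, .single (hη H)⟩
  have hred : BetaEtaRed (inst (headPart (app (var 1) (var 0)) []) H') H' :=
    .single (.inr (hη H'))
  by_cases hn : HasNormalForm H'
  · exact canonicalComponent_headPart hM (.inl ⟨hred, hH' hn⟩) .nil hred .refl
  · refine canonicalComponent_headPart hM (.inr ⟨fun h => hn ?_, rfl⟩) .nil .refl hred
    obtain ⟨K, hK, hK'⟩ := h
    obtain ⟨W, hKW, hW⟩ := hK.confluent hred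
    obtain rfl := hK'.eq_of_betaEtaRed hKW
    exact ⟨W, hW, hK'⟩

theorem NonHeadBeta.beta_step {s t : Term n} (h : NonHeadBeta s t) : Beta s t := by
  induction h with
  | lam _ ih => exact .lam ih
  | appR s h => exact .appR s h
  | appLam t h => exact .appL t (.lam h)
  | appL t _ ih => exact .appL t ih

theorem CanonicalComponent.left {G M N H H' : Term 0} (h : CanonicalComponent G M N H H') :
    BetaEtaRed (app G M) H := by
  obtain ⟨Y, L, n, Z, rfl, ⟨K, hK, hη⟩, _⟩ := h
  have hβ : BetaRed (inst (leafBody Y L Z) M) K :=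
    ReflTransGen.mono (fun _ _ => NonHeadBeta.beta_step) _ _ hK
  exact .head (.inl (.beta _ _)) (hβ.betaEtaRed.trans hη.betaEtaRed)

theorem CanonicalComponent.right {G M N H H' : Term 0} (h : CanonicalComponent G M N H H') :
    BetaEtaRed (app G N) H' := by
  obtain ⟨Y, L, n, Z, rfl, _, h₁, h₂, h₃, J₀, J, _, _, h₄, h₅⟩ := h
  exact h₁.trans (h₂.trans (h₃.betaEtaRed.trans (h₄.trans h₅)))

end

/-! ### Canonical endpieces -/

/-- The existence of an `X`-canonical proof of `F = F'`. -/
def CanonicallyProvable (X : Set (Term 0)) (F F' : Term 0) : Prop :=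
  ∃ T : ProofTree F F', T.IsCanonical X

/-- One component of an `X`-canonical endpiece, between settled confluence terms. -/
def Link (X : Set (Term 0)) (H H' : settled X) : Prop :=
  ∃ G M N, CanonicalComponent G M N H H' ∧ ∀ R, CanonicallyProvable X (app M R) (app N R)

/-- The existence of an `X`-canonical proof of `F = F'` that ends in an endpiece with settled
confluence terms. -/
def HasEndpiece (X : Set (Term 0)) (F F' : Term 0) : Prop :=
  ∃ H H' : settled X, BetaEtaRed F H ∧ BetaEtaRed F' H' ∧ ReflTransGen (Link X) H H'

section
variable {X : Set (Term 0)}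

theorem exists_components {H H' : settled X} (h : ReflTransGen (Link X) H H') :
    ∃ (t : ℕ) (G M N : Fin t → Term 0) (K : Fin (t + 1) → settled X),
      K 0 = H ∧ K (Fin.last t) = H' ∧
      (∀ i, CanonicalComponent (G i) (M i) (N i) (K i.castSucc) (K i.succ)) ∧
      ∀ i R, CanonicallyProvable X (app (M i) R) (app (N i) R) := by
  induction h using ReflTransGen.head_induction_on with
  | refl =>
    exact ⟨0, Fin.elim0, Fin.elim0, Fin.elim0, fun _ => H', rfl, rfl, fun i => i.elim0,
      fun i => i.elim0⟩
  | @head A _ h _ ih =>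
    obtain ⟨t, G, M, N, K, rfl, rfl, hK, hleaf⟩ := ih
    obtain ⟨G₀, M₀, N₀, hc₀, hleaf₀⟩ := h
    exact ⟨t + 1, Fin.cons G₀ G, Fin.cons M₀ M, Fin.cons N₀ N, Fin.cons A K, rfl, rfl,
      Fin.forall_fin_succ.2 ⟨hc₀, hK⟩, Fin.forall_fin_succ.2 ⟨hleaf₀, hleaf⟩⟩

namespace HasEndpiece

theorem canonicallyProvable {F F' : Term 0} (h : HasEndpiece X F F') :
    CanonicallyProvable X F F' := by
  obtain ⟨H, H', hF, hF', h⟩ := h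
  obtain ⟨t, G, M, N, K, rfl, rfl, hK, hleaf⟩ := exists_components h
  choose leaf hcanonical using hleaf
  exact ⟨.endpiece t G M N (fun i => K i) hF (fun i => (hK i).left) (fun i => (hK i).right) hF'
    leaf, fun i => (K i).2.1, hK, hcanonical⟩

theorem of_join (hX : Cofinal X) {F F' : Term 0} (h : Join BetaEtaRed F F') :
    HasEndpiece X F F' := by
  obtain ⟨W, hF, hF'⟩ := h
  obtain ⟨H, hH, hW⟩ := hX.settled W
  exact ⟨⟨H, hH⟩, ⟨H, hH⟩, hF.trans hW, hF'.trans hW, .refl⟩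

theorem of_common_expansion (hX : Cofinal X) {K F F' : Term 0} (h : BetaEtaRed K F)
    (h' : BetaEtaRed K F') : HasEndpiece X F F' :=
  .of_join hX (h.confluent h')

end HasEndpiece

theorem link_of_forall_hasEndpiece_app {H H' : settled X}
    (h : ∀ R, HasEndpiece X (app H R) (app H' R)) : Link X H H' :=
  ⟨_, H, H', canonicalComponent_eta H H'.2.2, fun R => (h R).canonicallyProvable⟩

namespace HasEndpiece

theorem trans (hX : Cofinal X) {F F' F'' : Term 0} (h : HasEndpiece X F F')
    (h' : HasEndpiece X F' F'') : HasEndpiece X F F'' := by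
  obtain ⟨H, H₁, hF, hF₁, hl⟩ := h
  obtain ⟨H₂, H', hF₂, hF', hl'⟩ := h'
  have hlink : Link X H₁ H₂ := link_of_forall_hasEndpiece_app fun R =>
    .of_common_expansion hX (hF₁.app (.refl (a := R))) (hF₂.app .refl)
  exact ⟨H, H', hF, hF', (hl.tail hlink).trans hl'⟩

theorem betaEtaRed_congr (hX : Cofinal X) {F F' A A' : Term 0} (h : HasEndpiece X F F')
    (hF : BetaEtaRed F A) (hF' : BetaEtaRed F' A') : HasEndpiece X A A' :=
  ((of_common_expansion hX hF .refl).trans hX h).trans hX (of_common_expansion hX .refl hF')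

theorem of_betaEtaRed (hX : Cofinal X) {F F' A A' : Term 0} (hF : BetaEtaRed F A)
    (hF' : BetaEtaRed F' A') (h : HasEndpiece X A A') : HasEndpiece X F F' :=
  ((of_common_expansion hX .refl hF).trans hX h).trans hX (of_common_expansion hX hF' .refl)

theorem omega (hX : Cofinal X) {F F' : Term 0} (h : ∀ R, HasEndpiece X (app F R) (app F' R)) :
    HasEndpiece X F F' := by
  obtain ⟨H, hH, hF⟩ := hX.settled F
  obtain ⟨H', hH', hF'⟩ := hX.settled F'
  exact ⟨⟨H, hH⟩, ⟨H', hH'⟩, hF, hF', .single <| link_of_forall_hasEndpiece_app fun R =>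
    (h R).betaEtaRed_congr hX (hF.app .refl) (hF'.app .refl)⟩

end HasEndpiece

end

/-! ### Congruence -/

namespace Term

/-- The variable `i` is the leftmost subterm of the term, which is not an abstraction. -/
def HeadedBy : {n : ℕ} → Term n → Fin n → Prop
  | _, var i, j => i = j
  | _, app s _, j => HeadedBy s j
  | _, lam _, _ => False

/-- The substitution of the closed term `M` for the outermost variable. Unlike `single`, which
instantiates the innermost variable, it is invariant under passage through a binder. -/
def outer {n : ℕ} (M : Term 0) : Fin (n + 1) → Term n :=
  Fin.lastCases (motive := fun _ => Term n) (emb M) var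

section
variable {n : ℕ}

theorem HeadedBy.exists_eq_apps {t : Term n} {i : Fin n} (h : HeadedBy t i) :
    ∃ ts, t = apps (var i) ts := by
  induction t with
  | var j => exact ⟨[], congrArg var h⟩
  | app s t ih _ =>
    obtain ⟨ts, rfl⟩ := ih h
    exact ⟨ts ++ [t], (apps_append_singleton _ _ _).symm⟩
  | lam t => exact h.elim

theorem headedBy_apps {s : Term n} {ts : List (Term n)} {i : Fin n} :
    HeadedBy (apps s ts) i ↔ HeadedBy s i := by
  induction ts generalizing s with
  | nil => rfl
  | cons t _ ih => exact ih (s := app s t)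

theorem HeadedBy.of_rename {m : ℕ} {f : Fin m → Fin n} {t : Term m} {i : Fin n}
    (h : HeadedBy (rename f t) i) : ∃ j, f j = i := by
  induction t with
  | var j => exact ⟨j, h⟩
  | app s t ih _ => exact ih h
  | lam t => exact h.elim

theorem not_headedBy_emb (t : Term 0) (i : Fin n) : ¬ HeadedBy (emb t) i :=
  fun h => h.of_rename.elim fun j _ => j.elim0

theorem exists_eq_apps_lam {t : Term n} (h : ∀ i, ¬ HeadedBy t i) :
    ∃ Y L, t = apps (lam Y) L := by
  induction t with
  | var i => exact absurd rfl (h i)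
  | app s t ih _ =>
    obtain ⟨Y, L, rfl⟩ := ih h
    exact ⟨Y, L ++ [t], (apps_append_singleton _ _ _).symm⟩
  | lam t => exact ⟨t, [], rfl⟩

@[simp] theorem outer_last (M : Term 0) : outer M (Fin.last n) = emb M := Fin.lastCases_last

@[simp] theorem outer_castSucc (M : Term 0) (i : Fin n) : outer M i.castSucc = var i :=
  Fin.lastCases_castSucc i

theorem up_outer (M : Term 0) : up (outer M : Fin (n + 1) → Term n) = outer M := by
  refine funext (Fin.forall_fin_succ.2 ⟨(outer_castSucc M 0).symm, fun i => ?_⟩)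
  cases i using Fin.lastCases with
  | last => rw [up_succ, outer_last, rename_emb, Fin.succ_last, outer_last]
  | cast i => rw [up_succ, outer_castSucc, Fin.succ_castSucc, outer_castSucc, rename_var]

theorem inst_eq_subst_outer (t : Term 1) (M : Term 0) : inst t M = subst (outer M) t := by
  rw [inst_eq_subst]
  congr 1
  exact funext (Fin.forall_fin_one.2 ((outer_last M).trans (emb_zero M)).symm)

theorem exists_outer_eq_var (M : Term 0) {i : Fin (n + 1)} (hi : i ≠ Fin.last n) :
    ∃ j, outer M i = var j := by
  obtain ⟨j, rfl⟩ := Fin.exists_castSucc_eq.2 hi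
  exact ⟨j, outer_castSucc M j⟩

theorem exists_of_subst_eq_lam {m : ℕ} {σ : Fin m → Term n} {b : Term m} {t : Term (n + 1)}
    (hb : ∀ i, HeadedBy b i → ∃ j, σ i = var j) (h : subst σ b = lam t) :
    ∃ b', b = lam b' ∧ t = subst (up σ) b' := by
  cases b with
  | var i =>
    obtain ⟨j, hj⟩ := hb i rfl
    cases hj.symm.trans h
  | app s t => cases h
  | lam b => exact ⟨b, rfl, (Term.lam.inj h).symm⟩

end

end Term

section
variable {m n : ℕ}

theorem Wh.exists_of_app {s t u : Term n} (h : Wh (app s t) u) :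
    (∃ v, s = lam v ∧ u = inst v t) ∨ ∃ s', Wh s s' ∧ u = app s' t := by
  cases h with
  | beta v _ => exact .inl ⟨v, rfl, rfl⟩
  | appL _ h => exact .inr ⟨_, h, rfl⟩

theorem Wh.exists_of_subst {σ : Fin m → Term n} {b : Term m} {c : Term n}
    (hb : ∀ i, HeadedBy b i → ∃ j, σ i = var j) (h : Wh (Term.subst σ b) c) :
    ∃ b', c = Term.subst σ b' ∧ Wh b b' := by
  induction b generalizing n with
  | var i =>
    obtain ⟨j, hj⟩ := hb i rfl
    rw [subst_var, hj] at h
    cases h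
  | app s t ih _ =>
    rcases Wh.exists_of_app h with ⟨v, hv, rfl⟩ | ⟨_, hs, rfl⟩
    · obtain ⟨s, rfl, rfl⟩ := exists_of_subst_eq_lam (b := s) hb hv
      exact ⟨inst s t, (subst_inst _ _ _).symm, .beta s t⟩
    · obtain ⟨s', rfl, hs'⟩ := ih hb hs
      exact ⟨app s' t, rfl, .appL t hs'⟩
  | lam b => cases h

end

/-- Terms all of whose closed instances have `X`-canonical endpieces. -/
def OpenEndpiece (X : Set (Term 0)) {n : ℕ} (s t : Term n) : Prop :=
  ∀ σ : Fin n → Term 0, HasEndpiece X (subst σ s) (subst σ t)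

/-- Closed terms whose equality, placed in an arbitrary context, has an `X`-canonical endpiece. -/
def Congruent (X : Set (Term 0)) (M N : Term 0) : Prop :=
  ∀ C : Term 1, HasEndpiece X (inst C M) (inst C N)

/-- The invariant under which head reductions of `[M/x]b` are followed, for `x` the outermost
variable: an `x` that gets into head position is frozen to `M`. The reduct `c = [M/x]b'` has a head
that does not come from `x`, and the corresponding `[N/x]b'` is still provably equal to `[N/x]b`. -/
def HeadLift (X : Set (Term 0)) (M N : Term 0) {n : ℕ} (b : Term (n + 1)) (c : Term n) : Prop :=
  ∃ b', c = subst (outer M) b' ∧ ¬ HeadedBy b' (Fin.last n) ∧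
    OpenEndpiece X (subst (outer N) b') (subst (outer N) b)

section
variable {X : Set (Term 0)} {n : ℕ}

namespace OpenEndpiece

theorem trans (hX : Cofinal X) {s t u : Term n} (h : OpenEndpiece X s t)
    (h' : OpenEndpiece X t u) : OpenEndpiece X s u := fun σ => (h σ).trans hX (h' σ)

theorem of_common_expansion (hX : Cofinal X) {k s t : Term n} (h : BetaEtaRed k s)
    (h' : BetaEtaRed k t) : OpenEndpiece X s t :=
  fun σ => .of_common_expansion hX (h.subst σ) (h'.subst σ)

theorem lam (hX : Cofinal X) {s t : Term (n + 1)} (h : OpenEndpiece X s t) :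
    OpenEndpiece X (lam s) (lam t) := by
  refine fun σ => .omega hX fun R => ?_
  have hβ (u : Term (n + 1)) : BetaEtaRed (app (subst σ u.lam) R) (subst (Fin.cases R σ) u) := by
    rw [← inst_subst_up]
    exact .single (.inl (.beta _ _))
  exact .of_betaEtaRed hX (hβ s) (hβ t) (h _)

end OpenEndpiece

namespace Congruent

theorem hasEndpiece {M N : Term 0} (h : Congruent X M N) : HasEndpiece X M N := h (var 0)

theorem inst {M N : Term 0} (h : Congruent X M N) (C : Term 1) :
    Congruent X (inst C M) (inst C N) := by
  intro D
  simpa only [inst_inst] using h (subst (fun _ => C) D)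

theorem app_left (P : Term 0) {M N : Term 0} (h : Congruent X M N) :
    Congruent X (app P M) (app P N) := by
  simpa only [inst_app, inst_emb, emb_zero, inst_var_zero] using h.inst (app (emb P) (var 0))

theorem app_right {M N : Term 0} (h : Congruent X M N) (R : Term 0) :
    Congruent X (app M R) (app N R) := by
  simpa only [inst_app, inst_emb, emb_zero, inst_var_zero] using h.inst (app (var 0) (emb R))

theorem apps {M N : Term 0} (h : Congruent X M N) (Rs : List (Term 0)) :
    Congruent X (apps M Rs) (apps N Rs) := by
  induction Rs generalizing M N with
  | nil => exact h
  | cons R _ ih => exact ih (h.app_right R)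

theorem trans (hX : Cofinal X) {M N P : Term 0} (h : Congruent X M N) (h' : Congruent X N P) :
    Congruent X M P := fun C => (h C).trans hX (h' C)

theorem of_join (hX : Cofinal X) {M N : Term 0} (h : Join BetaEtaRed M N) : Congruent X M N := by
  obtain ⟨W, hM, hN⟩ := h
  intro C
  have hβ (A : Term 0) : BetaEtaRed (app (.lam C) A) (Term.inst C A) := .single (.inl (.beta C A))
  have hW {A : Term 0} (hA : BetaEtaRed A W) :
      BetaEtaRed (app (.lam C) A) (Term.inst C W) :=
    (BetaEtaRed.app .refl hA).trans (hβ W)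
  exact (HasEndpiece.of_common_expansion hX (hβ M) (hW hM)).trans hX
    (.of_common_expansion hX (hW hN) (hβ N))

end Congruent

theorem openEndpiece_apps_emb (hX : Cofinal X) {M N : Term 0}
    (h : ∀ R, Congruent X (app M R) (app N R)) (ts : List (Term n)) :
    OpenEndpiece X (apps (emb M) ts) (apps (emb N) ts) := by
  intro σ
  simp only [subst_apps, subst_emb, emb_zero]
  cases ts with
  | nil => exact .omega hX fun R => (h R).hasEndpiece
  | cons t ts => exact ((h (subst σ t)).apps (ts.map (subst σ))).hasEndpiece

section
variable {M N : Term 0}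

theorem headLift_subst_outer (hX : Cofinal X) (h : ∀ R, Congruent X (app M R) (app N R))
    (b : Term (n + 1)) : HeadLift X M N b (subst (outer M) b) := by
  by_cases hb : HeadedBy b (Fin.last n)
  · obtain ⟨ts, rfl⟩ := hb.exists_eq_apps
    refine ⟨apps (emb M) ts, ?_, fun h => not_headedBy_emb M _ (headedBy_apps.1 h), ?_⟩
    · simp only [subst_apps, subst_emb, subst_var, outer_last]
    · simp only [subst_apps, subst_emb, subst_var, outer_last]
      exact openEndpiece_apps_emb hX h _
  · exact ⟨b, rfl, hb, .of_common_expansion hX .refl .refl⟩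

theorem HeadLift.of_openEndpiece (hX : Cofinal X) {b b' : Term (n + 1)} {c : Term n}
    (hc : HeadLift X M N b' c) (h : OpenEndpiece X (subst (outer N) b') (subst (outer N) b)) :
    HeadLift X M N b c :=
  hc.imp fun _ ⟨hM, hb, hN⟩ => ⟨hM, hb, hN.trans hX h⟩

theorem headLift_of_whRed (hX : Cofinal X) (h : ∀ R, Congruent X (app M R) (app N R))
    {b : Term (n + 1)} {c : Term n} (hc : WhRed (subst (outer M) b) c) : HeadLift X M N b c := by
  induction hc with
  | refl => exact headLift_subst_outer hX h b
  | tail _ hd ih =>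
    obtain ⟨b₁, rfl, hb₁, hN₁⟩ := ih
    obtain ⟨b₂, rfl, hwh⟩ := hd.exists_of_subst fun i hi =>
      exists_outer_eq_var M fun e => hb₁ (e ▸ hi)
    have hN₂ : OpenEndpiece X (subst (outer N) b₂) (subst (outer N) b₁) :=
      .of_common_expansion hX (.single (.inl (hwh.beta_step.subst _))) .refl
    exact (headLift_subst_outer hX h b₂).of_openEndpiece hX (hN₂.trans hX hN₁)

theorem headLift_of_headRed (hX : Cofinal X) (h : ∀ R, Congruent X (app M R) (app N R))
    {b : Term (n + 1)} {c : Term n} (hc : HeadRed (subst (outer M) b) c) :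
    HeadLift X M N b c := by
  generalize hs : subst (outer M) b = s at hc
  induction hc with
  | wh hc => exact headLift_of_whRed hX h (hs ▸ hc)
  | lam hc _ ih =>
    obtain ⟨b₁, hM, hb₁, hN⟩ := headLift_of_whRed hX h (hs ▸ hc)
    obtain ⟨b₂, rfl, hb₂⟩ := exists_of_subst_eq_lam
      (fun i hi => exists_outer_eq_var M fun e => hb₁ (e ▸ hi)) hM.symm
    rw [up_outer] at hb₂
    obtain ⟨b₃, rfl, _, hN'⟩ := ih hb₂.symm
    refine ⟨lam b₃, ?_, id, ?_⟩
    · rw [subst_lam, up_outer]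
    · rw [subst_lam, up_outer] at hN ⊢
      exact (hN'.lam hX).trans hX hN

theorem Congruent.omega (hX : Cofinal X) (h : ∀ R, Congruent X (app M R) (app N R)) :
    Congruent X M N := by
  intro C
  rw [inst_eq_subst_outer C M, inst_eq_subst_outer C N]
  obtain ⟨H, hH, hr⟩ := hX.settled (subst (outer M) C)
  obtain ⟨a, K, ha, hK, hη⟩ := hr.standard.exists_headRed_nonHeadRed_etaRed
  obtain ⟨b, rfl, hb, hN⟩ := headLift_of_headRed hX h ha
  obtain ⟨Y, L, rfl⟩ := exists_eq_apps_lam (Fin.forall_fin_one.2 hb)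
  rw [← inst_eq_subst_outer] at hK
  obtain ⟨H', hH', hr', hc⟩ :=
    hX.settled.exists_canonicalComponent (Y := Y) (L := L) ⟨K, hK, hη⟩ N
  have hlink : Link X ⟨H, hH⟩ ⟨H', hH'⟩ :=
    ⟨_, M, N, hc, fun R => (h R).hasEndpiece.canonicallyProvable⟩
  rw [inst_eq_subst_outer] at hr'
  refine HasEndpiece.trans hX ⟨⟨H, hH⟩, ⟨H', hH'⟩, hr, hr', .single hlink⟩ ?_
  simpa only [headPart, subst_zero] using hN Fin.elim0

theorem OmegaEq.congruent (hX : Cofinal X) (h : OmegaEq M N) :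
    Congruent X M N ∧ Congruent X N M := by
  induction h with
  | conv h => exact ⟨.of_join hX h.join, .of_join hX (BetaEtaConv.join (.symm _ _ h))⟩
  | app P _ ih => exact ⟨ih.1.app_left P, ih.2.app_left P⟩
  | symm _ ih => exact ih.symm
  | trans _ _ ih₁ ih₂ => exact ⟨ih₁.1.trans hX ih₂.1, ih₂.2.trans hX ih₁.2⟩
  | omega _ ih => exact ⟨.omega hX fun R => (ih R).1, .omega hX fun R => (ih R).2⟩

end

end

end LambdaOmega

theorem mainTheorem4_general (X : Set (LambdaOmega.Term 0)) (hX : LambdaOmega.Cofinal X)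
    (M N : LambdaOmega.Term 0) (h : LambdaOmega.OmegaEq M N) :
    ∃ T : LambdaOmega.ProofTree M N, T.IsCanonical X :=
  (h.congruent hX).1.hasEndpiece.canonicallyProvable

theorem mainTheorem4 (X : Set (LambdaOmega.Term 0)) (hX : LambdaOmega.Supercofinal X)
    (M N : LambdaOmega.Term 0) (h : LambdaOmega.OmegaEq M N) :
    ∃ T : LambdaOmega.ProofTree M N, T.IsCanonical X :=
  mainTheorem4_general X hX.1 M N h
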